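/- Let $\mathfrak H=\mathfrak H_0\oplus\mathfrak H_1$ be a complex Hilbert space decomposed into complementary orthogonal closed subspaces. Let $A_0$ and $A_1$ be closed (possibly unbounded) linear operators on $\mathfrak H_0$ and $\mathfrak H_1$, let $B:\mathfrak H_1\to\mathfrak H_0$ and $C:\mathfrak H_0\to\mathfrak H_1$ be bounded linear operators with $C=-B^*$, and put $$A=\begin{pmatrix}A_0&0\\0&A_1\end{pmatrix},\qquad V=\begin{pmatrix}0&B\\C&0\end{pmatrix},\qquad L=A+V,\qquad \mathrm{Dom}(L)=\mathrm{Dom}(A)=\mathrm{Dom}(A_0)\oplus\mathrm{Dom}(A_1).$$ For an operator $T$, let $W(T)=\{(Tx,x) : x\in\mathrm{Dom}(T),\ \|x\|=1\}$ be its numerical range, $\rho(T)$ its resolvent set (the $z\in\mathbb C$ for which $T-z:\mathrm{Dom}(T)\to\mathfrak H$ has a bounded, everywhere defined inverse) and $\mathrm{spec}(T)=\mathbb C\setminus\rho(T)$ its spectrum. Let $a,b\in\mathbb R$. (i) If $\mathrm{Re}\,w\le a$ for all $w\in W(A)$ and $\rho(A)\cap\{z\in\mathbb C : \mathrm{Re}\,z>a\}\neq\emptyset$,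 then $\mathrm{Re}\,z\le a$ for all $z\in\mathrm{spec}(L)$. (ii) If $\mathrm{Re}\,w\ge b$ for all $w\in W(A)$ and $\rho(A)\cap\{z\in\mathbb C : \mathrm{Re}\,z<b\}\neq\emptyset$, then $\mathrm{Re}\,z\ge b$ for all $z\in\mathrm{spec}(L)$. In particular, if $A$ is self-adjoint, then $$\inf\mathrm{spec}(A)\le\mathrm{Re}\,z\le\sup\mathrm{spec}(A)\qquad\text{for all } z\in\mathrm{spec}(L),$$ where the infimum and the supremum are taken in $[-\infty,\infty]$. No bound on $\|V\|$ is assumed in any of these statements. -/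

import Mathlib

open scoped InnerProductSpace

namespace BlockOp

noncomputable section

/-- The resolvent set of a (possibly unbounded) operator `T` on a complex normed space: those `z`
for which `T - z : Dom T → E` has a bounded, everywhere defined two-sided inverse `R`. -/
def resolventSet {E : Type*} [NormedAddCommGroup E] [NormedSpace ℂ E] (T : E →ₗ.[ℂ] E) : Set ℂ :=
  {z | ∃ R : E →L[ℂ] E,
    (∀ y : E, ∃ h : R y ∈ T.domain, T ⟨R y, h⟩ - z • R y = y) ∧
    (∀ x : T.domain, R (T x - z • (x : E)) = x)}

/-- The spectrum: the complement of the resolvent set. -/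
def spec {E : Type*} [NormedAddCommGroup E] [NormedSpace ℂ E] (T : E →ₗ.[ℂ] E) : Set ℂ :=
  (resolventSet T)ᶜ

/-- The numerical range `{(T x, x) | x ∈ Dom T, ‖x‖ = 1}`. Mathlib's inner product is linear in the
second argument, so `(T x, x)`, with a product linear in the first argument, is `⟪x, T x⟫`. -/
def numericalRange {E : Type*} [NormedAddCommGroup E] [InnerProductSpace ℂ E]
    (T : E →ₗ.[ℂ] E) : Set ℂ :=
  {w | ∃ x : T.domain, ‖(x : E)‖ = 1 ∧ ⟪(x : E), T x⟫_ℂ = w}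

/-- The block diagonal operator `diag(A₀, A₁)` on `H = H₀ ⊕ H₀ᗮ`: its domain is
`Dom A₀ ⊕ Dom A₁`, i.e. the vectors whose two components lie in `Dom A₀` and `Dom A₁`. -/
def blockDiag {H : Type*} [NormedAddCommGroup H] [InnerProductSpace ℂ H]
    (H₀ : Submodule ℂ H) [H₀.HasOrthogonalProjection]
    (A₀ : H₀ →ₗ.[ℂ] H₀) (A₁ : H₀ᗮ →ₗ.[ℂ] H₀ᗮ) : H →ₗ.[ℂ] H where
  domain := A₀.domain.comap H₀.orthogonalProjectionOnto.toLinearMap ⊓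
    A₁.domain.comap H₀ᗮ.orthogonalProjectionOnto.toLinearMap
  toFun :=
    { toFun := fun x =>
        ((A₀ ⟨H₀.orthogonalProjectionOnto (x : H), x.2.1⟩ : H₀) : H) +
          ((A₁ ⟨H₀ᗮ.orthogonalProjectionOnto (x : H), x.2.2⟩ : H₀ᗮ) : H)
      map_add' := by
        intro x y
        have h0 : (⟨H₀.orthogonalProjectionOnto ((x + y : _) : H), (x + y).2.1⟩ : A₀.domain) =
            ⟨H₀.orthogonalProjectionOnto (x : H), x.2.1⟩ +
              ⟨H₀.orthogonalProjectionOnto (y : H), y.2.1⟩ := by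
          ext; simp
        have h1 : (⟨H₀ᗮ.orthogonalProjectionOnto ((x + y : _) : H), (x + y).2.2⟩ : A₁.domain) =
            ⟨H₀ᗮ.orthogonalProjectionOnto (x : H), x.2.2⟩ +
              ⟨H₀ᗮ.orthogonalProjectionOnto (y : H), y.2.2⟩ := by
          apply Subtype.ext
          exact map_add H₀ᗮ.orthogonalProjectionOnto (x : H) (y : H)
        rw [h0, h1, LinearPMap.map_add, LinearPMap.map_add, Submodule.coe_add, Submodule.coe_add]
        abel
      map_smul' := by
        intro c x
        have h0 : (⟨H₀.orthogonalProjectionOnto ((c • x : _) : H), (c • x).2.1⟩ : A₀.domain) =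
            c • ⟨H₀.orthogonalProjectionOnto (x : H), x.2.1⟩ := by
          apply Subtype.ext
          exact map_smul H₀.orthogonalProjectionOnto c (x : H)
        have h1 : (⟨H₀ᗮ.orthogonalProjectionOnto ((c • x : _) : H), (c • x).2.2⟩ : A₁.domain) =
            c • ⟨H₀ᗮ.orthogonalProjectionOnto (x : H), x.2.2⟩ := by
          apply Subtype.ext
          exact map_smul H₀ᗮ.orthogonalProjectionOnto c (x : H)
        rw [h0, h1, LinearPMap.map_smul, LinearPMap.map_smul]
        simp [smul_add] }

/-- The bounded off-diagonal operator `V (x₀ + x₁) = B x₁ + C x₀` on `H = H₀ ⊕ H₀ᗮ`. -/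
def offDiag {H : Type*} [NormedAddCommGroup H] [InnerProductSpace ℂ H]
    (H₀ : Submodule ℂ H) [H₀.HasOrthogonalProjection]
    (B : H₀ᗮ →L[ℂ] H₀) (C : H₀ →L[ℂ] H₀ᗮ) : H →L[ℂ] H :=
  H₀.subtypeL ∘L B ∘L H₀ᗮ.orthogonalProjectionOnto + H₀ᗮ.subtypeL ∘L C ∘L H₀.orthogonalProjectionOnto

/-- The sum `T + V` of an operator `T` and a bounded operator `V`, with domain `Dom T`. -/
def addBounded {E : Type*} [NormedAddCommGroup E] [NormedSpace ℂ E]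
    (T : E →ₗ.[ℂ] E) (V : E →L[ℂ] E) : E →ₗ.[ℂ] E where
  domain := T.domain
  toFun := T.toFun + V.toLinearMap ∘ₗ T.domain.subtype

/-- The infimum of the real points of a set of complex numbers, in the extended reals. -/
def realInf (S : Set ℂ) : EReal := sInf ((fun t : ℝ => (t : EReal)) '' {t : ℝ | (t : ℂ) ∈ S})

/-- The supremum of the real points of a set of complex numbers, in the extended reals. -/
def realSup (S : Set ℂ) : EReal := sSup ((fun t : ℝ => (t : EReal)) '' {t : ℝ | (t : ℂ) ∈ S})

end

end BlockOp

/-! Since `C = -B*`, the form of `V` is purely imaginary, so `A` and `L` have the same real part of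
the quadratic form, whatever `‖V‖` is. An upper bound `a` on it forces `‖(T - z)⁻¹‖ ≤ 1 / (Re z -
a)` wherever the resolvent exists with `Re z > a`. Hence the resolvent set is open and relatively
closed in this half-plane, which lies in it as soon as one point does
(`mem_resolventSet_of_dissipative`). For `L` such a point comes from a Neumann series far to the
right (`mem_resolventSet_addBounded_of_dissipative`). Lower bounds follow by negation.

For self-adjoint `A`, the form bounds are recovered from the real resolvent points: below the
spectrum the resolvent is a positive operator (`IsResolventAt.isPositive`). -/

namespace BlockOp

/-! ### Resolvents under bounded perturbation, shift and negation. -/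

section Resolvent

variable {E : Type*} [NormedAddCommGroup E] [NormedSpace ℂ E]

/-- `R` is a bounded two-sided inverse of `T - z`. -/
def IsResolventAt (T : E →ₗ.[ℂ] E) (z : ℂ) (R : E →L[ℂ] E) : Prop :=
  (∀ y : E, ∃ h : R y ∈ T.domain, T ⟨R y, h⟩ - z • R y = y) ∧
    (∀ x : T.domain, R (T x - z • (x : E)) = x)

theorem addBounded_apply (T : E →ₗ.[ℂ] E) (V : E →L[ℂ] E) (x : T.domain) :
    addBounded T V x = T x + V x := rfl

/-- `T + K - z = (1 + K R)(T - z)`, and a Neumann series inverts the first factor. -/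
theorem IsResolventAt.exists_addBounded [CompleteSpace E] {T : E →ₗ.[ℂ] E} {z : ℂ}
    {R : E →L[ℂ] E} (hR : IsResolventAt T z R) (K : E →L[ℂ] E) (hK : ‖K‖ * ‖R‖ < 1) :
    z ∈ resolventSet (addBounded T K) := by
  have hKR : ‖-(K * R)‖ < 1 := by
    rw [norm_neg]
    exact (norm_mul_le K R).trans_lt hK
  obtain ⟨u, hu⟩ := isUnit_one_sub_of_norm_lt_one hKR
  have hu' : ∀ y, (u : E →L[ℂ] E) y = y + K (R y) := fun y => by
    rw [hu]
    simp
  have hright : ∀ y, (u : E →L[ℂ] E) ((↑u⁻¹ : E →L[ℂ] E) y) = y := fun y => by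
    rw [← mul_apply_eq_comp, Units.mul_inv, one_apply_eq_self]
  have hleft : ∀ y, (↑u⁻¹ : E →L[ℂ] E) ((u : E →L[ℂ] E) y) = y := fun y => by
    rw [← mul_apply_eq_comp, Units.inv_mul, one_apply_eq_self]
  refine ⟨R * ↑u⁻¹, fun y => ?_, fun x => ?_⟩
  · obtain ⟨h, h'⟩ := hR.1 ((↑u⁻¹ : E →L[ℂ] E) y)
    refine ⟨h, ?_⟩
    have h2 := hright y
    rw [hu'] at h2
    calc T ⟨R ((↑u⁻¹ : E →L[ℂ] E) y), h⟩ + K (R ((↑u⁻¹ : E →L[ℂ] E) y))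
          - z • R ((↑u⁻¹ : E →L[ℂ] E) y)
        = (T ⟨R ((↑u⁻¹ : E →L[ℂ] E) y), h⟩ - z • R ((↑u⁻¹ : E →L[ℂ] E) y))
          + K (R ((↑u⁻¹ : E →L[ℂ] E) y)) := by abel
      _ = y := by rw [h', h2]
  · have hx : R (T x - z • (x : E)) = x := hR.2 x
    have h2 : addBounded T K x - z • (x : E) = (u : E →L[ℂ] E) (T x - z • (x : E)) := by
      rw [hu', hx, addBounded_apply T K x]
      abel
    change R ((↑u⁻¹ : E →L[ℂ] E) (addBounded T K x - z • (x : E))) = x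
    rw [h2, hleft, hx]

theorem mem_resolventSet_addBounded_smul_iff {T : E →ₗ.[ℂ] E} {z c : ℂ} :
    z ∈ resolventSet (addBounded T (c • (1 : E →L[ℂ] E))) ↔ z - c ∈ resolventSet T := by
  have key : ∀ x : T.domain, addBounded T (c • (1 : E →L[ℂ] E)) x - z • (x : E)
      = T x - (z - c) • (x : E) := fun x => by
    rw [addBounded_apply T _ x, sub_smul]
    simp only [_root_.smul_apply, one_apply_eq_self]
    abel
  constructor
  · rintro ⟨R, h1, h2⟩
    refine ⟨R, fun y => ?_, fun x => ?_⟩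
    · obtain ⟨h, h'⟩ := h1 y
      exact ⟨h, (key ⟨R y, h⟩).symm.trans h'⟩
    · rw [← key]
      exact h2 x
  · rintro ⟨R, h1, h2⟩
    refine ⟨R, fun y => ?_, fun x => ?_⟩
    · obtain ⟨h, h'⟩ := h1 y
      exact ⟨h, (key ⟨R y, h⟩).trans h'⟩
    · exact (congrArg R (key x)).trans (h2 x)

theorem IsResolventAt.mem_resolventSet_of_norm_sub_mul_lt [CompleteSpace E] {T : E →ₗ.[ℂ] E}
    {z w : ℂ} {R : E →L[ℂ] E} (hR : IsResolventAt T z R) (hw : ‖w - z‖ * ‖R‖ < 1) :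
    w ∈ resolventSet T := by
  have h : ‖(z - w) • (1 : E →L[ℂ] E)‖ * ‖R‖ < 1 := by
    refine lt_of_le_of_lt (mul_le_mul_of_nonneg_right ?_ (norm_nonneg R)) hw
    rw [norm_smul, norm_sub_rev]
    exact mul_le_of_le_one_right (norm_nonneg _) ContinuousLinearMap.norm_id_le
  have := mem_resolventSet_addBounded_smul_iff.1 (hR.exists_addBounded _ h)
  rwa [sub_sub_cancel] at this

theorem isOpen_resolventSet [CompleteSpace E] (T : E →ₗ.[ℂ] E) : IsOpen (resolventSet T) := by
  rw [Metric.isOpen_iff]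
  rintro z ⟨R, hR⟩
  have hpos : 0 < ‖R‖ + 1 := by positivity
  refine ⟨(‖R‖ + 1)⁻¹, inv_pos.2 hpos, fun w hw => ?_⟩
  refine IsResolventAt.mem_resolventSet_of_norm_sub_mul_lt hR ?_
  rw [Metric.mem_ball, dist_eq_norm] at hw
  calc ‖w - z‖ * ‖R‖ ≤ ‖w - z‖ * (‖R‖ + 1) := by gcongr; linarith
    _ < (‖R‖ + 1)⁻¹ * (‖R‖ + 1) := by gcongr
    _ = 1 := inv_mul_cancel₀ hpos.ne'

theorem neg_mem_resolventSet_neg {T : E →ₗ.[ℂ] E} {z : ℂ} (hz : z ∈ resolventSet T) :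
    -z ∈ resolventSet (-T) := by
  obtain ⟨R, h1, h2⟩ := hz
  refine ⟨-R, fun y => ?_, fun x => ?_⟩
  · obtain ⟨h, h'⟩ := h1 y
    refine ⟨T.domain.neg_mem h, ?_⟩
    have h3 : T ⟨-R y, T.domain.neg_mem h⟩ = -T ⟨R y, h⟩ := LinearPMap.map_neg T ⟨R y, h⟩
    change -T ⟨-R y, T.domain.neg_mem h⟩ - (-z) • (-R y) = y
    rw [h3, neg_neg, neg_smul_neg, h']
  · have h3 : (-T) x - (-z) • (x : E) = -(T x - z • (x : E)) := by
      rw [LinearPMap.neg_apply, neg_smul]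
      abel
    rw [h3, _root_.neg_apply, map_neg, neg_neg]
    exact h2 x

theorem neg_mem_resolventSet_neg_iff {T : E →ₗ.[ℂ] E} {z : ℂ} :
    -z ∈ resolventSet (-T) ↔ z ∈ resolventSet T := by
  refine ⟨fun h => ?_, neg_mem_resolventSet_neg⟩
  simpa using neg_mem_resolventSet_neg h

theorem addBounded_neg (T : E →ₗ.[ℂ] E) (V : E →L[ℂ] E) :
    addBounded (-T) (-V) = -addBounded T V := by
  refine LinearPMap.ext rfl fun x hx hx' => ?_
  change -T ⟨x, hx⟩ + -V x = -(T ⟨x, hx⟩ + V x)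
  abel

end Resolvent

/-! ### Form bounds and half-planes in the resolvent set. -/

section Dissipative

variable {E : Type*} [NormedAddCommGroup E] [InnerProductSpace ℂ E]

theorem re_inner_smul_self (z : ℂ) (x : E) : (⟪x, z • x⟫_ℂ).re = z.re * ‖x‖ ^ 2 := by
  have h : ⟪x, x⟫_ℂ = ((‖x‖ ^ 2 : ℝ) : ℂ) := by
    rw [inner_self_eq_norm_sq_to_K, Complex.ofReal_pow]
    rfl
  rw [inner_smul_right, h, Complex.re_mul_ofReal]

theorem re_inner_le_of_numericalRange {T : E →ₗ.[ℂ] E} {a : ℝ}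
    (h : ∀ w ∈ numericalRange T, w.re ≤ a) (x : T.domain) :
    (⟪(x : E), T x⟫_ℂ).re ≤ a * ‖(x : E)‖ ^ 2 := by
  by_cases hx : (x : E) = 0
  · simp [hx]
  have hn : 0 < ‖(x : E)‖ := norm_pos_iff.2 hx
  set r : ℝ := ‖(x : E)‖⁻¹ with hr
  have hmem : ⟪(((r : ℂ) • x : T.domain) : E), T ((r : ℂ) • x)⟫_ℂ ∈ numericalRange T := by
    refine ⟨(r : ℂ) • x, ?_, rfl⟩
    rw [Submodule.coe_smul, norm_smul, Complex.norm_real, Real.norm_eq_abs,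
      abs_of_pos (inv_pos.2 hn), inv_mul_cancel₀ hn.ne']
  have h1 := h _ hmem
  rw [LinearPMap.map_smul, Submodule.coe_smul, inner_smul_left, inner_smul_right,
    Complex.conj_ofReal, Complex.re_ofReal_mul, Complex.re_ofReal_mul, hr] at h1
  calc (⟪(x : E), T x⟫_ℂ).re
      = (‖(x : E)‖⁻¹ * (‖(x : E)‖⁻¹ * (⟪(x : E), T x⟫_ℂ).re)) * ‖(x : E)‖ ^ 2 := by
        field_simp
    _ ≤ a * ‖(x : E)‖ ^ 2 := by gcongr

/-- Cauchy–Schwarz applied to `⟪x, (T - z) x⟫`. -/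
theorem mul_norm_le_norm_sub_smul {T : E →ₗ.[ℂ] E} {a : ℝ}
    (h : ∀ x : T.domain, (⟪(x : E), T x⟫_ℂ).re ≤ a * ‖(x : E)‖ ^ 2) (z : ℂ) (x : T.domain) :
    (z.re - a) * ‖(x : E)‖ ≤ ‖T x - z • (x : E)‖ := by
  by_cases hx : (x : E) = 0
  · simp [hx]
  have hn : 0 < ‖(x : E)‖ := norm_pos_iff.2 hx
  have h1 : (⟪(x : E), T x - z • (x : E)⟫_ℂ).re
      = (⟪(x : E), T x⟫_ℂ).re - z.re * ‖(x : E)‖ ^ 2 := by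
    rw [inner_sub_right, Complex.sub_re, re_inner_smul_self]
  have h2 : -(⟪(x : E), T x - z • (x : E)⟫_ℂ).re ≤ ‖(x : E)‖ * ‖T x - z • (x : E)‖ :=
    (neg_le_abs _).trans ((Complex.abs_re_le_norm _).trans (norm_inner_le_norm _ _))
  have h3 := h x
  refine le_of_mul_le_mul_left ?_ hn
  nlinarith

theorem IsResolventAt.norm_le {T : E →ₗ.[ℂ] E} {a : ℝ}
    (h : ∀ x : T.domain, (⟪(x : E), T x⟫_ℂ).re ≤ a * ‖(x : E)‖ ^ 2) {z : ℂ} (hz : a < z.re)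
    {R : E →L[ℂ] E} (hR : IsResolventAt T z R) : ‖R‖ ≤ (z.re - a)⁻¹ := by
  have hpos : 0 < z.re - a := sub_pos.2 hz
  refine R.opNorm_le_bound (inv_nonneg.2 hpos.le) fun y => ?_
  obtain ⟨hy, hy'⟩ := hR.1 y
  have h1 := mul_norm_le_norm_sub_smul h z ⟨R y, hy⟩
  rw [hy'] at h1
  rwa [inv_mul_eq_div, le_div_iff₀' hpos]

theorem mem_resolventSet_of_dissipative [CompleteSpace E] {T : E →ₗ.[ℂ] E} {a : ℝ}
    (h : ∀ x : T.domain, (⟪(x : E), T x⟫_ℂ).re ≤ a * ‖(x : E)‖ ^ 2)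
    (hne : (resolventSet T ∩ {z : ℂ | a < z.re}).Nonempty) {z : ℂ} (hz : a < z.re) :
    z ∈ resolventSet T := by
  have hpre : IsPreconnected {z : ℂ | a < z.re} := (convex_halfSpace_re_gt a).isPreconnected
  refine hpre.subset_of_closure_inter_subset (isOpen_resolventSet T)
    (by rwa [Set.inter_comm]) ?_ hz
  rintro w ⟨hw, hwa : a < w.re⟩
  have hpos : 0 < w.re - a := sub_pos.2 hwa
  -- Within half the distance to the boundary line, `‖w - v‖ < v.re - a`, so the resolvent disc
  -- around `v` contains `w`.
  obtain ⟨v, ⟨R, hR⟩, hv⟩ := Metric.mem_closure_iff.1 hw ((w.re - a) / 2) (half_pos hpos)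
  rw [dist_eq_norm] at hv
  have hre : w.re - v.re ≤ ‖w - v‖ := by
    rw [← Complex.sub_re]
    exact Complex.re_le_norm _
  have hva : 0 < v.re - a := by linarith
  refine IsResolventAt.mem_resolventSet_of_norm_sub_mul_lt hR ?_
  calc ‖w - v‖ * ‖R‖ ≤ ‖w - v‖ * (v.re - a)⁻¹ := by
        gcongr
        exact IsResolventAt.norm_le h (sub_pos.1 hva) hR
    _ < 1 := by
        rw [← div_eq_mul_inv, div_lt_one hva]
        linarith

theorem mem_resolventSet_addBounded_of_dissipative [CompleteSpace E] {T : E →ₗ.[ℂ] E}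
    {V : E →L[ℂ] E} (hV : ∀ x, (⟪x, V x⟫_ℂ).re = 0) {a : ℝ}
    (h : ∀ x : T.domain, (⟪(x : E), T x⟫_ℂ).re ≤ a * ‖(x : E)‖ ^ 2)
    (hne : (resolventSet T ∩ {z : ℂ | a < z.re}).Nonempty) {z : ℂ} (hz : a < z.re) :
    z ∈ resolventSet (addBounded T V) := by
  refine mem_resolventSet_of_dissipative (a := a) (fun x => ?_) ?_ hz
  · rw [addBounded_apply T V x, inner_add_right, Complex.add_re, hV, add_zero]
    exact h x
  · have hpos : 0 < ‖V‖ + 1 := by positivity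
    have hz₀ : a < ((a + (‖V‖ + 1) : ℝ) : ℂ).re := by
      rw [Complex.ofReal_re]
      linarith
    -- At this point `‖R‖ ≤ 1 / (‖V‖ + 1)`, hence `‖V‖ * ‖R‖ < 1`.
    refine ⟨((a + (‖V‖ + 1) : ℝ) : ℂ), ?_, hz₀⟩
    obtain ⟨R, hR⟩ := mem_resolventSet_of_dissipative h hne hz₀
    refine IsResolventAt.exists_addBounded hR V ?_
    have hn := IsResolventAt.norm_le h hz₀ hR
    rw [Complex.ofReal_re, add_sub_cancel_left] at hn
    calc ‖V‖ * ‖R‖ ≤ ‖V‖ * (‖V‖ + 1)⁻¹ := by gcongr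
      _ < 1 := by
        rw [← div_eq_mul_inv, div_lt_one hpos]
        linarith

theorem mem_resolventSet_addBounded_of_accretive [CompleteSpace E] {T : E →ₗ.[ℂ] E}
    {V : E →L[ℂ] E} (hV : ∀ x, (⟪x, V x⟫_ℂ).re = 0) {b : ℝ}
    (h : ∀ x : T.domain, b * ‖(x : E)‖ ^ 2 ≤ (⟪(x : E), T x⟫_ℂ).re)
    (hne : (resolventSet T ∩ {z : ℂ | z.re < b}).Nonempty) {z : ℂ} (hz : z.re < b) :
    z ∈ resolventSet (addBounded T V) := by
  rw [← neg_mem_resolventSet_neg_iff, ← addBounded_neg]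
  refine mem_resolventSet_addBounded_of_dissipative (a := -b) (fun x => ?_) (fun x => ?_) ?_ ?_
  · simp [hV]
  · rw [LinearPMap.neg_apply, inner_neg_right, Complex.neg_re, neg_mul]
    exact neg_le_neg (h x)
  · obtain ⟨w, hw, hwb⟩ := hne
    exact ⟨-w, neg_mem_resolventSet_neg hw, by simpa using hwb⟩
  · simpa using hz

theorem le_re_inner_of_numericalRange {T : E →ₗ.[ℂ] E} {b : ℝ}
    (h : ∀ w ∈ numericalRange T, b ≤ w.re) (x : T.domain) :
    b * ‖(x : E)‖ ^ 2 ≤ (⟪(x : E), T x⟫_ℂ).re := by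
  have := re_inner_le_of_numericalRange (T := -T) (a := -b) (fun w => ?_) x
  · rw [LinearPMap.neg_apply, inner_neg_right, Complex.neg_re, neg_mul] at this
    exact neg_le_neg_iff.1 this
  · rintro ⟨y, hy, rfl⟩
    rw [LinearPMap.neg_apply, inner_neg_right, Complex.neg_re]
    exact neg_le_neg (h _ ⟨y, hy, rfl⟩)

end Dissipative

/-! ### From real resolvent points to form bounds for symmetric operators. -/

section Symmetric

variable {E : Type*} [NormedAddCommGroup E] [InnerProductSpace ℂ E]

theorem IsResolventAt.isSymmetric {T : E →ₗ.[ℂ] E} (hT : T.IsFormalAdjoint T) {t : ℝ}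
    {R : E →L[ℂ] E} (hR : IsResolventAt T t R) (u v : E) : ⟪R u, v⟫_ℂ = ⟪u, R v⟫_ℂ := by
  obtain ⟨hu, hu'⟩ := hR.1 u
  obtain ⟨hv, hv'⟩ := hR.1 v
  have h := hT ⟨R u, hu⟩ ⟨R v, hv⟩
  conv_lhs => rw [← hv']
  conv_rhs => rw [← hu']
  rw [inner_sub_left, inner_sub_right, inner_smul_left, inner_smul_right, Complex.conj_ofReal]
  exact congrArg (· - _) h.symm

/-- A nonzero `c` is in the resolvent set of `(T - z)⁻¹` if `z + c⁻¹` is in that of `T`. -/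
theorem IsResolventAt.isUnit_smul_one_sub {T : E →ₗ.[ℂ] E} {z c : ℂ} (hc : c ≠ 0)
    {R S : E →L[ℂ] E} (hR : IsResolventAt T z R) (hS : IsResolventAt T (z + c⁻¹) S) :
    IsUnit (c • (1 : E →L[ℂ] E) - R) := by
  have hRS : ∀ y, S y - R y = c⁻¹ • R (S y) := fun y => by
    obtain ⟨h, h'⟩ := hS.1 y
    have h2 := hR.2 ⟨S y, h⟩
    have h3 : T ⟨S y, h⟩ - z • S y = y + c⁻¹ • S y := by
      rw [add_smul, sub_add_eq_sub_sub, sub_eq_iff_eq_add] at h'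
      exact h'
    rw [h3, map_add, map_smul] at h2
    rw [sub_eq_iff_eq_add', h2]
  have hSR : ∀ y, S y - R y = c⁻¹ • S (R y) := fun y => by
    obtain ⟨h, h'⟩ := hR.1 y
    have h2 := hS.2 ⟨R y, h⟩
    have h3 : T ⟨R y, h⟩ - (z + c⁻¹) • R y = y - c⁻¹ • R y := by
      rw [add_smul, sub_add_eq_sub_sub, h']
    rw [h3, map_sub, map_smul] at h2
    change _ = R y at h2
    rw [← h2, sub_sub_cancel, h2]
  -- `c - R = c (T - z - c⁻¹) R` has inverse `c⁻¹ (T - z) S`, and `(T - z) S = 1 + c⁻¹ S`.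
  refine ⟨⟨_, c⁻¹ • (1 + c⁻¹ • S), ?_, ?_⟩, rfl⟩
  · ext y
    have h := hRS y
    simp only [mul_apply_eq_comp, _root_.sub_apply,
      _root_.smul_apply, one_apply_eq_self, _root_.add_apply,
      map_add, map_smul, ← h, smul_add, smul_sub, inv_smul_smul₀ hc]
    abel
  · ext y
    have h := hSR y
    simp only [mul_apply_eq_comp, _root_.sub_apply,
      _root_.smul_apply, one_apply_eq_self, _root_.add_apply,
      map_sub, map_smul, smul_sub, ← h, smul_inv_smul₀ hc, smul_add]
    abel

/-- A spectral value `c < 0` of `R` would put `t + c⁻¹ < t < b` in the spectrum of `T`. -/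
theorem IsResolventAt.isPositive [CompleteSpace E] {T : E →ₗ.[ℂ] E} (hT : T.IsFormalAdjoint T)
    {b t : ℝ} (hb : ∀ s : ℝ, s < b → (s : ℂ) ∈ resolventSet T) (ht : t < b)
    {R : E →L[ℂ] E} (hR : IsResolventAt T t R) : R.IsPositive := by
  have hsa : IsSelfAdjoint R :=
    ContinuousLinearMap.isSelfAdjoint_iff_isSymmetric.2 (hR.isSymmetric hT)
  rw [← ContinuousLinearMap.nonneg_iff_isPositive,
    StarOrderedRing.nonneg_iff_spectrum_nonneg (R := ℝ) R hsa]
  intro c hc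
  by_contra! hneg
  refine hc ?_
  obtain ⟨S, hS⟩ := hb (t + c⁻¹) (by linarith [inv_lt_zero.2 hneg])
  have hS' : IsResolventAt T ((t : ℂ) + (c : ℂ)⁻¹) S := by
    have h : ((t + c⁻¹ : ℝ) : ℂ) = (t : ℂ) + (c : ℂ)⁻¹ := by push_cast; rfl
    rw [← h]
    exact hS
  have hu := hR.isUnit_smul_one_sub (Complex.ofReal_ne_zero.2 hneg.ne) hS'
  rw [spectrum.mem_resolventSet_iff, Algebra.algebraMap_eq_smul_one]
  exact hu

/-- Positivity of `R = (T - t)⁻¹`, tested on `(T - t) x`, gives the bound with `t < b`; `b` itself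
may be spectral, so `t` tends to `b`. -/
theorem le_re_inner_of_forall_mem_resolventSet [CompleteSpace E] {T : E →ₗ.[ℂ] E}
    (hT : T.IsFormalAdjoint T) {b : ℝ} (hb : ∀ s : ℝ, s < b → (s : ℂ) ∈ resolventSet T)
    (x : T.domain) : b * ‖(x : E)‖ ^ 2 ≤ (⟪(x : E), T x⟫_ℂ).re := by
  have key : ∀ t : ℝ, t < b → t * ‖(x : E)‖ ^ 2 ≤ (⟪(x : E), T x⟫_ℂ).re := fun t ht => by
    obtain ⟨R, hR⟩ := hb t ht
    have h := (IsResolventAt.isPositive hT hb ht hR).re_inner_nonneg_left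
      (T x - (t : ℂ) • (x : E))
    rw [hR.2 x] at h
    change 0 ≤ (⟪(x : E), T x - (t : ℂ) • (x : E)⟫_ℂ).re at h
    rwa [inner_sub_right, Complex.sub_re, re_inner_smul_self, Complex.ofReal_re, sub_nonneg] at h
  have hlim : Filter.Tendsto (fun t : ℝ => t * ‖(x : E)‖ ^ 2) (nhdsWithin b (Set.Iio b))
      (nhds (b * ‖(x : E)‖ ^ 2)) :=
    ((continuous_id.mul continuous_const).tendsto b).mono_left nhdsWithin_le_nhds
  exact le_of_tendsto hlim (Filter.eventually_of_mem self_mem_nhdsWithin key)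

theorem re_inner_le_of_forall_mem_resolventSet [CompleteSpace E] {T : E →ₗ.[ℂ] E}
    (hT : T.IsFormalAdjoint T) {a : ℝ} (ha : ∀ s : ℝ, a < s → (s : ℂ) ∈ resolventSet T)
    (x : T.domain) : (⟪(x : E), T x⟫_ℂ).re ≤ a * ‖(x : E)‖ ^ 2 := by
  have hT' : (-T).IsFormalAdjoint (-T) := fun x y => by
    rw [LinearPMap.neg_apply, LinearPMap.neg_apply, inner_neg_left, inner_neg_right]
    exact congrArg Neg.neg (hT x y)
  have h := le_re_inner_of_forall_mem_resolventSet hT' (b := -a) (fun s hs => ?_) x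
  · rw [LinearPMap.neg_apply, inner_neg_right, Complex.neg_re, neg_mul] at h
    exact neg_le_neg_iff.1 h
  · have := neg_mem_resolventSet_neg (ha (-s) (by linarith))
    simpa using this

end Symmetric

/-- The two cross terms are `w` and `-conj w`. -/
theorem re_inner_offDiag_eq_zero {H : Type*} [NormedAddCommGroup H] [InnerProductSpace ℂ H]
    [CompleteSpace H] (H₀ : Submodule ℂ H) [CompleteSpace H₀] (B : H₀ᗮ →L[ℂ] H₀) (x : H) :
    (⟪x, offDiag H₀ B (-ContinuousLinearMap.adjoint B) x⟫_ℂ).re = 0 := by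
  have h0 : ∀ u : H₀, ⟪x, (u : H)⟫_ℂ = ⟪H₀.orthogonalProjectionOnto x, u⟫_ℂ := fun u =>
    (Submodule.inner_orthogonalProjectionOnto_eq_of_mem_right u x).symm
  have h1 : ∀ u : H₀ᗮ, ⟪x, (u : H)⟫_ℂ = ⟪H₀ᗮ.orthogonalProjectionOnto x, u⟫_ℂ := fun u =>
    (Submodule.inner_orthogonalProjectionOnto_eq_of_mem_right u x).symm
  change (⟪x, ((B (H₀ᗮ.orthogonalProjectionOnto x) : H₀) : H) +
    (((-ContinuousLinearMap.adjoint B) (H₀.orthogonalProjectionOnto x) : H₀ᗮ) : H)⟫_ℂ).re = 0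
  rw [inner_add_right, h0, h1, _root_.neg_apply, inner_neg_right,
    ContinuousLinearMap.adjoint_inner_right, Complex.add_re, Complex.neg_re,
    ← inner_conj_symm (B _), Complex.conj_re, add_neg_cancel]

theorem mem_resolventSet_of_lt_realInf {E : Type*} [NormedAddCommGroup E] [NormedSpace ℂ E]
    {T : E →ₗ.[ℂ] E} {s : ℝ} (hs : (s : EReal) < realInf (spec T)) :
    (s : ℂ) ∈ resolventSet T := by
  by_contra h
  exact absurd (sInf_le (Set.mem_image_of_mem _ h)) hs.not_ge

theorem mem_resolventSet_of_realSup_lt {E : Type*} [NormedAddCommGroup E] [NormedSpace ℂ E]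
    {T : E →ₗ.[ℂ] E} {s : ℝ} (hs : realSup (spec T) < (s : EReal)) :
    (s : ℂ) ∈ resolventSet T := by
  by_contra h
  exact absurd (le_sSup (Set.mem_image_of_mem _ h)) hs.not_ge

end BlockOp

/-- Spectral enclosure for `L = A + V` with `A = diag(A₀, A₁)` closed and `V` off-diagonal with
entries `B` and `C = -B*`, on `H = H₀ ⊕ H₀ᗮ`. -/
theorem theorem5p8 {H : Type*} [NormedAddCommGroup H] [InnerProductSpace ℂ H] [CompleteSpace H]
    (H₀ : Submodule ℂ H) [CompleteSpace H₀]
    (A₀ : H₀ →ₗ.[ℂ] H₀) (A₁ : H₀ᗮ →ₗ.[ℂ] H₀ᗮ) (hA₀ : A₀.IsClosed) (hA₁ : A₁.IsClosed)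
    (B : H₀ᗮ →L[ℂ] H₀) (C : H₀ →L[ℂ] H₀ᗮ) (hC : C = -ContinuousLinearMap.adjoint B)
    (A L : H →ₗ.[ℂ] H) (hA : A = BlockOp.blockDiag H₀ A₀ A₁)
    (hL : L = BlockOp.addBounded A (BlockOp.offDiag H₀ B C)) (a b : ℝ) :
    ((∀ w ∈ BlockOp.numericalRange A, w.re ≤ a) →
      (BlockOp.resolventSet A ∩ {z : ℂ | a < z.re}).Nonempty →
      ∀ z ∈ BlockOp.spec L, z.re ≤ a) ∧
    ((∀ w ∈ BlockOp.numericalRange A, b ≤ w.re) →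
      (BlockOp.resolventSet A ∩ {z : ℂ | z.re < b}).Nonempty →
      ∀ z ∈ BlockOp.spec L, b ≤ z.re) ∧
    (IsSelfAdjoint A →
      ∀ z ∈ BlockOp.spec L,
        BlockOp.realInf (BlockOp.spec A) ≤ (z.re : EReal) ∧
        (z.re : EReal) ≤ BlockOp.realSup (BlockOp.spec A)) := by
  have hV : ∀ x, (⟪x, BlockOp.offDiag H₀ B C x⟫_ℂ).re = 0 := fun x => by
    rw [hC]
    exact BlockOp.re_inner_offDiag_eq_zero H₀ B x
  rw [hL]
  refine ⟨fun hW hne z hz => ?_, fun hW hne z hz => ?_, fun hsa z hz => ⟨?_, ?_⟩⟩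
  · by_contra! hza
    exact hz (BlockOp.mem_resolventSet_addBounded_of_dissipative hV
      (BlockOp.re_inner_le_of_numericalRange hW) hne hza)
  · by_contra! hzb
    exact hz (BlockOp.mem_resolventSet_addBounded_of_accretive hV
      (BlockOp.le_re_inner_of_numericalRange hW) hne hzb)
  all_goals
    have hsym : A.IsFormalAdjoint A := by
      have h := A.adjoint_isFormalAdjoint hsa.dense_domain
      rwa [LinearPMap.isSelfAdjoint_def.1 hsa] at h
    by_contra! hlt
    -- A real `c` strictly between replaces the extended-real bound, which may be infinite.
    obtain ⟨c, hc₁, hc₂⟩ := EReal.lt_iff_exists_real_btwn.1 hlt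
  · have hc : ∀ s : ℝ, s < c → (s : ℂ) ∈ BlockOp.resolventSet A := fun s hs =>
      BlockOp.mem_resolventSet_of_lt_realInf ((EReal.coe_lt_coe_iff.2 hs).trans hc₂)
    exact hz (BlockOp.mem_resolventSet_addBounded_of_accretive hV
      (BlockOp.le_re_inner_of_forall_mem_resolventSet hsym hc)
      ⟨((c - 1 : ℝ) : ℂ), hc _ (sub_one_lt c), by simp⟩ (EReal.coe_lt_coe_iff.1 hc₁))
  · have hc : ∀ s : ℝ, c < s → (s : ℂ) ∈ BlockOp.resolventSet A := fun s hs =>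
      BlockOp.mem_resolventSet_of_realSup_lt (hc₁.trans (EReal.coe_lt_coe_iff.2 hs))
    exact hz (BlockOp.mem_resolventSet_addBounded_of_dissipative hV
      (BlockOp.re_inner_le_of_forall_mem_resolventSet hsym hc)
      ⟨((c + 1 : ℝ) : ℂ), hc _ (lt_add_one c), by simp⟩ (EReal.coe_lt_coe_iff.1 hc₂))
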